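/- **Black-box model.** Let $\mathcal H_S$ be the Hilbert space of a system of $n$ qubits. A black-box algorithm is a finite adaptive procedure on $\mathcal H_S\otimes\mathbb C^m$. It starts with a single copy of a state $\psi_0$ in the system register and then makes finitely many steps, each of which is either - a quantum instrument that does not depend on the Hamiltonian (this covers unitary gates, channels, adding or discarding ancillas, measurements and classical randomness), whose outcome may determine all later steps; or - a controlled evolution $\sum_w e^{iHt_w}\otimes|w\rangle\langle w|$ under the unknown Hamiltonian $H$ of the system, with times $t_w\in\mathbb R$ of either sign, which costs evolution time $\max_w|t_w|$. Finally it outputs a real number. The *evolution time* of the algorithm on $(H,\psi_0)$ is the total cost of its controlled evolutions, in expectation over the measurement outcomes (so it is at most the worst-case total cost). A Hermitian $H$ is *$\Delta$-gapped* with ground state $\psi_0$ if $\psi_0$ is a unit eigenvector with energy $E_0$ and every eigenvector orthogonal to $\psi_0$ has energy at least $E_0+\Delta$. The algorithm *learns* $\langle\psi_0|A|\psi_0\rangle$ to precision $\epsilon$ with probability $p$ on $(H,\psi_0)$ if, with probability at least $p$, its output differs from $\langle\psi_0|A|\psi_0\rangle$ by at most $\epsilon$. The algorithm may depend on $A,\epsilon,\Delta,p$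 (and on $\Lambda$ below), but not on $H$ or $\psi_0$. **Statement.** For every constant $p>0$ there are constants $c,\epsilon_0>0$, depending only on $p$, such that for all $\Delta>0$ and all $0<\epsilon<\epsilon_0$ the following hold. 1. For every $\theta\in\mathbb R$, the single-qubit Hamiltonian $H_\theta=-\Delta(\cos\theta\,X+\sin\theta\,Y)$ is $\Delta$-gapped with ground state $\psi_\theta=\frac1{\sqrt2}(|0\rangle+e^{i\theta}|1\rangle)$. 2. Let $A=X$ or $A=Y$. Any black-box algorithm on one qubit that, for every $\theta$, learns $\langle\psi_\theta|A|\psi_\theta\rangle$ to precision $\epsilon$ with probability $p$ on $(H_\theta,\psi_\theta)$ has evolution time at least $\dfrac{c}{\Delta\epsilon}$ on $(H_\theta,\psi_\theta)$ for some $\theta$. 3. Let $n\ge1$, let $A$ be the Pauli operator $X$ or $Y$ on any one of $n$ qubits, and let $\Lambda\ge\Delta$. Any black-box algorithm on $n$ qubits that learns $\langle\psi_0|A|\psi_0\rangle$ to precision $\epsilon$ with probability $p$ on every pair $(H,\psi_0)$, where $H$ is an $n$-qubit $\Delta$-gapped Hamiltonian with $\|H\|\le\Lambda$ and ground state $\psi_0$,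 has evolution time at least $\dfrac{c}{\Delta\epsilon}$ on some such pair. -/

import Mathlib

noncomputable section

open Matrix

/-- The squared Euclidean norm of a (possibly unnormalised) state vector. -/
def weight {I : Type} [Fintype I] (φ : I → ℂ) : ℝ := ∑ a, ‖φ a‖ ^ 2

/-- The expectation value `⟨ψ|A|ψ⟩` of an observable. -/
def expectation {S : Type} [Fintype S] (A : Matrix S S ℂ) (ψ : S → ℂ) : ℝ :=
  (star ψ ⬝ᵥ (A *ᵥ ψ)).re

/-- `H` is a `Δ`-gapped Hamiltonian with normalised ground state `ψ`: `ψ` is an eigenvector with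
some energy `E₀`, and every eigenvector orthogonal to `ψ` has energy at least `E₀ + Δ`. (For
`0 < Δ` this says that the lowest eigenvalue is simple and that `E₁ - E₀ ≥ Δ`.) -/
structure IsGappedGroundState {S : Type} [Fintype S]
    (Δ : ℝ) (H : Matrix S S ℂ) (ψ : S → ℂ) : Prop where
  hermitian : H.IsHermitian
  normalized : weight ψ = 1
  gapped : ∃ E₀ : ℝ, H *ᵥ ψ = (E₀ : ℂ) • ψ ∧
    ∀ (μ : ℝ) (v : S → ℂ), v ≠ 0 → star ψ ⬝ᵥ v = 0 → H *ᵥ v = (μ : ℂ) • v → E₀ + Δ ≤ μ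

/-- The time evolution `e^{iHt}`; `t` may have either sign. -/
def evolution {S : Type} [Fintype S] [DecidableEq S] (H : Matrix S S ℂ) (t : ℝ) : Matrix S S ℂ :=
  NormedSpace.exp ((Complex.I * (t : ℂ)) • H)

/-- Controlled evolution `∑_w e^{i H t_w} ⊗ |w⟩⟨w|` on the system `S` and an ancilla of dimension
`m`. Ordinary controlled evolution is the case where `t_w` is `0` or a fixed `±t`, depending on a
control bit stored in `w`. -/
def controlledEvolution {S : Type} [Fintype S] [DecidableEq S] {m : ℕ}
    (H : Matrix S S ℂ) (t : Fin m → ℝ) (φ : S × Fin m → ℂ) : S × Fin m → ℂ :=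
  fun a => ∑ s, evolution H (t a.2) a.1 s * φ (s, a.2)

/-- Adaptive quantum algorithms with black-box access to the evolution of a Hamiltonian on the
system `S`. A term of `BlackBoxAlg S m` is what remains to be done when the current quantum memory
is `ℂ^S ⊗ ℂ^m`. It is a finite decision tree that does not mention the Hamiltonian.
* `output x`: stop, and return the estimate `x`.
* `query t next`: apply `∑_w e^{i H t_w} ⊗ |w⟩⟨w|`.
* `measure K hK next`: apply the quantum instrument with Kraus operators `K i`, where
  `∑ᵢ Kᵢ† Kᵢ = 1`, and continue with `next i` on outcome `i`. The ancilla dimension may change.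
  This covers unitary gates, channels, adding, swapping and discarding registers, measurements
  with classical control of everything that follows, and classical randomness. -/
inductive BlackBoxAlg (S : Type) [Fintype S] [DecidableEq S] : ℕ → Type
  | output {m : ℕ} (x : ℝ) : BlackBoxAlg S m
  | query {m : ℕ} (t : Fin m → ℝ) (next : BlackBoxAlg S m) : BlackBoxAlg S m
  | measure {m r : ℕ} {m' : Fin r → ℕ}
      (K : (i : Fin r) → Matrix (S × Fin (m' i)) (S × Fin m) ℂ)
      (hK : ∑ i, (K i)ᴴ * K i = 1)
      (next : (i : Fin r) → BlackBoxAlg S (m' i)) : BlackBoxAlg S m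

namespace BlackBoxAlg

variable {S : Type} [Fintype S] [DecidableEq S]

open Classical in
/-- The probability that the output lies in `G`, for black-box Hamiltonian `H` and current state
`φ`. The vector `φ` is unnormalised: its weight is the probability of reaching the node. -/
def outputProb (H : Matrix S S ℂ) (G : Set ℝ) :
    {m : ℕ} → BlackBoxAlg S m → (S × Fin m → ℂ) → ℝ
  | _, output x, φ => if x ∈ G then weight φ else 0
  | _, query t next, φ => outputProb H G next (controlledEvolution H t φ)
  | _, measure K _ next, φ => ∑ i, outputProb H G (next i) (K i *ᵥ φ)

/-- The expected total evolution time, for black-box Hamiltonian `H` and current (unnormalised)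
state `φ`. A query costs `‖t‖`, which is the sup norm `max_w |t_w|`. The expectation is over the
measurement outcomes, and so it is at most the largest total time along any branch. -/
def expectedTime (H : Matrix S S ℂ) :
    {m : ℕ} → BlackBoxAlg S m → (S × Fin m → ℂ) → ℝ
  | _, output _, _ => 0
  | _, query t next, φ => ‖t‖ * weight φ + expectedTime H next (controlledEvolution H t φ)
  | _, measure K _ next, φ => ∑ i, expectedTime H (next i) (K i *ᵥ φ)

/-- The initial memory: one copy of `ψ`, and a one-dimensional (trivial) ancilla. -/
def initialState (ψ : S → ℂ) : S × Fin 1 → ℂ := fun a => ψ a.1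

/-- Given one copy of `ψ` and the black box for `H`, the algorithm outputs `⟨ψ|A|ψ⟩` up to an
additive error `ε` with probability at least `p`. -/
def Learns (𝒜 : BlackBoxAlg S 1) (A : Matrix S S ℂ) (ε p : ℝ)
    (H : Matrix S S ℂ) (ψ : S → ℂ) : Prop :=
  p ≤ 𝒜.outputProb H {x | |x - expectation A ψ| ≤ ε} (initialState ψ)

/-- The expected total evolution time of the algorithm started on one copy of `ψ`. -/
def evolutionTime (𝒜 : BlackBoxAlg S 1) (H : Matrix S S ℂ) (ψ : S → ℂ) : ℝ :=
  𝒜.expectedTime H (initialState ψ)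

end BlackBoxAlg

/-- The Pauli matrix `X`. -/
def pauliX : Matrix (Fin 2) (Fin 2) ℂ := !![0, 1; 1, 0]

/-- The Pauli matrix `Y`. -/
def pauliY : Matrix (Fin 2) (Fin 2) ℂ := !![0, -Complex.I; Complex.I, 0]

/-- The single-qubit Hamiltonian `-Δ (cos θ X + sin θ Y)`. -/
def qubitHamiltonian (Δ θ : ℝ) : Matrix (Fin 2) (Fin 2) ℂ :=
  -((Δ : ℂ) • ((Real.cos θ : ℂ) • pauliX + (Real.sin θ : ℂ) • pauliY))

/-- The state `(|0⟩ + e^{iθ} |1⟩) / √2`. -/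
def qubitGroundState (θ : ℝ) : Fin 2 → ℂ :=
  ((Real.sqrt 2 : ℂ))⁻¹ • ![1, Complex.exp (Complex.I * (θ : ℂ))]

/-- The single-qubit operator `σ` acting on qubit `i` of `n` qubits, whose computational basis is
`Fin n → Fin 2`. -/
def onQubit {n : ℕ} (i : Fin n) (σ : Matrix (Fin 2) (Fin 2) ℂ) :
    Matrix (Fin n → Fin 2) (Fin n → Fin 2) ℂ :=
  Matrix.of fun x y => if ∀ j, j ≠ i → x j = y j then σ (x i) (y i) else 0

end

open Matrix

/-! ### Squared norms of unnormalised states -/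

section Weight

variable {I J : Type} [Fintype I] [Fintype J]

/-! A hybrid argument with many alternatives. Along a family `α - β |ψ θ⟩⟨ψ θ|` whose ground states
vary at unit rate in `θ`, expectation values `3εk` for `k < N` are reached within `O(εN)` of a
reference `θ`. Their `ε`-windows are disjoint, so on the reference input some window has probability
at most `1/N ≤ p/8`, yet on its own input it must have probability at least `p`. Two alternatives
would not do for small `p`, since guessing could succeed.

The two runs are compared through the squared distance of their unnormalised states
(`outputProb_le_of_evolutionsClose`). It starts small, is preserved in total by instruments, and
grows at a query by at most `O(ΔεN)` times the cost of that query in the two runs. Being additive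
over branches, it is controlled by expected rather than worst-case time. So a gap of order `p`
forces expected time of order `p / (NΔε)`. For `n` qubits the same family is embedded with the other
qubits in `|0⟩`. -/

theorem weight_eq_norm_sq (φ : I → ℂ) : weight φ = ‖WithLp.toLp 2 φ‖ ^ 2 := by
  rw [EuclideanSpace.norm_sq_eq]; rfl

theorem weight_nonneg (φ : I → ℂ) : 0 ≤ weight φ :=
  Finset.sum_nonneg fun _ _ => by positivity

theorem ofReal_weight (φ : I → ℂ) : (weight φ : ℂ) = star φ ⬝ᵥ φ := by
  simp [weight, dotProduct, ← Complex.conj_mul']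

theorem weight_prod (φ : I × J → ℂ) : weight φ = ∑ j, weight fun i => φ (i, j) := by
  simp only [weight]
  rw [Fintype.sum_prod_type_right]

theorem weight_le_two_mul_add (φ φ' : I → ℂ) :
    weight φ' ≤ 2 * weight φ + 2 * weight (φ' - φ) := by
  simp only [weight, Finset.mul_sum, ← Finset.sum_add_distrib]
  refine Finset.sum_le_sum fun a _ => ?_
  have h : ‖φ' a‖ ≤ ‖φ a‖ + ‖(φ' - φ) a‖ := by
    calc ‖φ' a‖ = ‖φ a + (φ' - φ) a‖ := by simp
      _ ≤ _ := norm_add_le _ _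
  nlinarith [norm_nonneg (φ' a), sq_nonneg (‖φ a‖ - ‖(φ' - φ) a‖)]

theorem sum_weight_mulVec [DecidableEq I] {r : ℕ} {κ : Fin r → Type} [∀ i, Fintype (κ i)]
    (K : (i : Fin r) → Matrix (κ i) I ℂ) (hK : ∑ i, (K i)ᴴ * K i = 1) (φ : I → ℂ) :
    ∑ i, weight (K i *ᵥ φ) = weight φ := by
  apply Complex.ofReal_injective
  push_cast
  simp only [ofReal_weight, star_mulVec]
  calc ∑ i, (star φ ᵥ* (K i)ᴴ) ⬝ᵥ (K i *ᵥ φ)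
      = star φ ⬝ᵥ ((∑ i, (K i)ᴴ * K i) *ᵥ φ) := by
        rw [Matrix.sum_mulVec, dotProduct_sum]
        exact Finset.sum_congr rfl fun i _ => by
          rw [← dotProduct_mulVec, mulVec_mulVec]
    _ = _ := by rw [hK, one_mulVec]

theorem weight_mulVec [DecidableEq I] {U : Matrix I I ℂ} (hU : Uᴴ * U = 1) (φ : I → ℂ) :
    weight (U *ᵥ φ) = weight φ := by
  simpa using sum_weight_mulVec (r := 1) (fun _ => U) (by simpa using hU) φ

/-- As `U y` and `U' y` have equal norm, replacing one by the other changes the squared distance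
only by the cross term `2 Re ⟨(U' - U) y, U x⟩`, at most `2η‖x‖‖y‖`. AM-GM turns this into weights,
which add up over branches. -/
theorem weight_mulVec_sub_mulVec_le [DecidableEq I] {U U' : Matrix I I ℂ} (hU : Uᴴ * U = 1)
    (hU' : U'ᴴ * U' = 1) {η : ℝ} (hη : 0 ≤ η)
    (h : ∀ y, weight (U' *ᵥ y - U *ᵥ y) ≤ η ^ 2 * weight y) (x y : I → ℂ) :
    weight (U' *ᵥ y - U *ᵥ x) ≤ weight (y - x) + η * (weight x + weight y) := by
  have hx := weight_mulVec hU x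
  have hy := weight_mulVec hU y
  have hy' := weight_mulVec hU' y
  have hyx := weight_mulVec hU (y - x)
  have hd := h y
  rw [mulVec_sub] at hyx
  simp only [weight_eq_norm_sq, WithLp.toLp_sub] at *
  set a := WithLp.toLp 2 (U *ᵥ x)
  set b := WithLp.toLp 2 (U *ᵥ y)
  set b' := WithLp.toLp 2 (U' *ᵥ y)
  rw [← hyx]
  have h1 := norm_sub_sq (𝕜 := ℂ) b' a
  have h2 := norm_sub_sq (𝕜 := ℂ) b a
  have h3 : RCLike.re (inner ℂ b' a) = RCLike.re (inner ℂ b a) + RCLike.re (inner ℂ (b' - b) a) := by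
    rw [inner_sub_left, map_sub]; ring
  have h4 : |RCLike.re (inner ℂ (b' - b) a)| ≤ ‖b' - b‖ * ‖a‖ :=
    (RCLike.abs_re_le_norm _).trans (norm_inner_le_norm _ _)
  have h5 : ‖b' - b‖ ≤ η * ‖WithLp.toLp 2 y‖ :=
    le_of_sq_le_sq (by rw [mul_pow]; exact hd) (by positivity)
  have h6 : ‖a‖ = ‖WithLp.toLp 2 x‖ := by
    rwa [sq_eq_sq₀ (norm_nonneg _) (norm_nonneg _)] at hx
  have h7 : ‖b' - b‖ * ‖a‖ ≤ η * ‖WithLp.toLp 2 y‖ * ‖WithLp.toLp 2 x‖ := by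
    rw [h6]; gcongr
  have h8 : η * ‖WithLp.toLp 2 y‖ * ‖WithLp.toLp 2 x‖ * 2 ≤
      η * (‖WithLp.toLp 2 x‖ ^ 2 + ‖WithLp.toLp 2 y‖ ^ 2) := by
    nlinarith [mul_nonneg hη (sq_nonneg (‖WithLp.toLp 2 x‖ - ‖WithLp.toLp 2 y‖))]
  have h9 := neg_le_of_abs_le h4
  linarith [hy, hy']

end Weight

/-! ### Closeness of controlled evolutions -/

section Evolution

variable {S : Type} [Fintype S] [DecidableEq S]

theorem evolution_conjTranspose_mul_self {H : Matrix S S ℂ} (hH : H.IsHermitian) (t : ℝ) :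
    (evolution H t)ᴴ * evolution H t = 1 := by
  have h : ((Complex.I * (t : ℂ)) • H)ᴴ = -((Complex.I * (t : ℂ)) • H) := by
    rw [conjTranspose_smul, hH.eq]; simp
  rw [evolution, ← Matrix.exp_conjTranspose, h, Matrix.exp_neg]
  exact Matrix.nonsing_inv_mul _ ((Matrix.isUnit_iff_isUnit_det _).1 (Matrix.isUnit_exp _))

theorem controlledEvolution_apply {m : ℕ} (H : Matrix S S ℂ) (t : Fin m → ℝ)
    (φ : S × Fin m → ℂ) (w : Fin m) :
    (fun s => controlledEvolution H t φ (s, w)) = evolution H (t w) *ᵥ fun s => φ (s, w) := rfl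

theorem weight_controlledEvolution {m : ℕ} {H : Matrix S S ℂ} (hH : H.IsHermitian)
    (t : Fin m → ℝ) (φ : S × Fin m → ℂ) :
    weight (controlledEvolution H t φ) = weight φ := by
  simp only [weight_prod, controlledEvolution_apply,
    weight_mulVec (evolution_conjTranspose_mul_self hH _)]

/-- The evolutions under `H` and `H'` differ in operator norm by at most `δ |t|`. -/
def EvolutionsClose (δ : ℝ) (H H' : Matrix S S ℂ) : Prop :=
  ∀ (t : ℝ) (y : S → ℂ),
    weight (evolution H' t *ᵥ y - evolution H t *ᵥ y) ≤ (δ * |t|) ^ 2 * weight y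

/-- The control values give orthogonal blocks, so the bound for each `t w` sums. The added term is
`δ` times the query's contribution to `expectedTime` in the two runs. -/
theorem EvolutionsClose.weight_controlledEvolution_sub_le {m : ℕ} {δ : ℝ} {H H' : Matrix S S ℂ}
    (h : EvolutionsClose δ H H') (hδ : 0 ≤ δ) (hH : H.IsHermitian) (hH' : H'.IsHermitian)
    (t : Fin m → ℝ) (φ φ' : S × Fin m → ℂ) :
    weight (controlledEvolution H' t φ' - controlledEvolution H t φ) ≤
      weight (φ' - φ) + δ * (‖t‖ * weight φ + ‖t‖ * weight φ') := by
  simp only [weight_prod, Finset.mul_sum, ← Finset.sum_add_distrib]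
  refine Finset.sum_le_sum fun w _ => ?_
  refine (weight_mulVec_sub_mulVec_le (evolution_conjTranspose_mul_self hH (t w))
    (evolution_conjTranspose_mul_self hH' (t w)) (by positivity : 0 ≤ δ * |t w|) (h (t w))
    (fun s => φ (s, w)) (fun s => φ' (s, w))).trans ?_
  have ht : |t w| ≤ ‖t‖ := norm_le_pi_norm t w
  have h1 : δ * |t w| * (weight (fun s => φ (s, w)) + weight (fun s => φ' (s, w))) ≤
      δ * ‖t‖ * (weight (fun s => φ (s, w)) + weight (fun s => φ' (s, w))) := by
    gcongr
    exact add_nonneg (weight_nonneg _) (weight_nonneg _)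
  refine le_of_le_of_eq (add_le_add_right h1 _) ?_
  simp only [Pi.sub_def]
  ring

end Evolution

/-! ### Disjoint outputs and the hybrid argument -/

namespace BlackBoxAlg

variable {S : Type} [Fintype S] [DecidableEq S]

theorem sum_outputProb_le_weight {H : Matrix S S ℂ} (hH : H.IsHermitian) {κ : Type} [Fintype κ]
    {G : κ → Set ℝ} (hG : Pairwise fun k l => Disjoint (G k) (G l)) {m : ℕ}
    (𝒜 : BlackBoxAlg S m) (φ : S × Fin m → ℂ) :
    ∑ k, 𝒜.outputProb H (G k) φ ≤ weight φ := by
  classical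
  induction 𝒜 with
  | output x =>
    simp only [outputProb]
    by_cases hx : ∃ k, x ∈ G k
    · obtain ⟨k, hk⟩ := hx
      rw [Finset.sum_eq_single k]
      · simp [hk]
      · intro l _ hl
        exact if_neg fun hxl => (Set.disjoint_left.1 (hG hl)) hxl hk
      · simp
    · push Not at hx
      simp [hx, weight_nonneg]
  | query t next ih =>
    simp only [outputProb]
    exact (ih _).trans_eq (weight_controlledEvolution hH t φ)
  | measure K hK next ih =>
    simp only [outputProb]
    rw [Finset.sum_comm, ← sum_weight_mulVec K hK φ]
    exact Finset.sum_le_sum fun i _ => ih i _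

/-- The hybrid argument. -/
theorem outputProb_le_of_evolutionsClose {δ : ℝ} (hδ : 0 ≤ δ) {H H' : Matrix S S ℂ}
    (hH : H.IsHermitian) (hH' : H'.IsHermitian) (h : EvolutionsClose δ H H') (G : Set ℝ) {m : ℕ}
    (𝒜 : BlackBoxAlg S m) (φ φ' : S × Fin m → ℂ) :
    𝒜.outputProb H' G φ' ≤ 2 * 𝒜.outputProb H G φ +
      2 * (weight (φ' - φ) + δ * (𝒜.expectedTime H φ + 𝒜.expectedTime H' φ')) := by
  induction 𝒜 with
  | output x =>
    simp only [outputProb, expectedTime]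
    split_ifs
    -- The factor 2 is lost only here, at the leaves.
    · simpa using weight_le_two_mul_add φ φ'
    · have := weight_nonneg (φ' - φ)
      simpa using this
  | query t next ih =>
    simp only [outputProb, expectedTime]
    have h1 := ih (controlledEvolution H t φ) (controlledEvolution H' t φ')
    have h2 := h.weight_controlledEvolution_sub_le hδ hH hH' t φ φ'
    linarith
  | measure K hK next ih =>
    simp only [outputProb, expectedTime]
    -- The instrument splits the squared distance among the outcomes without loss.
    rw [← sum_weight_mulVec K hK (φ' - φ), ← Finset.sum_add_distrib, Finset.mul_sum,
      Finset.mul_sum, ← Finset.sum_add_distrib, Finset.mul_sum, ← Finset.sum_add_distrib]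
    refine Finset.sum_le_sum fun i _ => ?_
    rw [mulVec_sub]
    exact ih i _ _

end BlackBoxAlg

/-! ### Rank-one Hamiltonians and their evolutions -/

theorem NormedSpace.exp_smul_of_isIdempotentElem {𝔸 : Type*} [NormedRing 𝔸] [NormedAlgebra ℂ 𝔸]
    [CompleteSpace 𝔸] {e : 𝔸} (he : IsIdempotentElem e) (z : ℂ) :
    NormedSpace.exp (z • e) = 1 + (Complex.exp z - 1) • e := by
  have h1 := NormedSpace.exp_series_hasSum_exp' (𝕂 := ℂ) (z • e)
  have h2 := (NormedSpace.exp_series_hasSum_exp' (𝕂 := ℂ) z).smul_const e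
  -- `e ^ n = e` except at `n = 0`, where the series needs the correction `1 - e`.
  have h3 := h2.add (hasSum_ite_eq 0 (1 - e))
  rw [← Complex.exp_eq_exp_ℂ] at h3
  refine (h1.unique (h3.congr_fun ?_)).trans ?_
  · intro n
    rcases n with _ | n
    · simp
    · simp [smul_pow, he.pow_succ_eq, smul_smul]
  · rw [sub_smul, one_smul]; abel

theorem isIdempotentElem_vecMulVec {S : Type} [Fintype S] {ψ : S → ℂ} (hψ : weight ψ = 1) :
    IsIdempotentElem (vecMulVec ψ (star ψ)) := by
  rw [IsIdempotentElem, vecMulVec_mul_vecMulVec, ← ofReal_weight, hψ]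
  simp

section RankOne

variable {S : Type} [Fintype S] [DecidableEq S]

/-- The Hamiltonian `α - β |ψ⟩⟨ψ|`. -/
def rankOneHamiltonian (α β : ℝ) (ψ : S → ℂ) : Matrix S S ℂ :=
  (α : ℂ) • (1 : Matrix S S ℂ) - (β : ℂ) • vecMulVec ψ (star ψ)

theorem rankOneHamiltonian_isHermitian {S : Type} [DecidableEq S] (α β : ℝ) (ψ : S → ℂ) :
    (rankOneHamiltonian α β ψ).IsHermitian := by
  simp [IsHermitian, rankOneHamiltonian, conjTranspose_sub, conjTranspose_smul,
    conjTranspose_vecMulVec]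

theorem rankOneHamiltonian_apply {S : Type} [DecidableEq S] (α β : ℝ) (ψ : S → ℂ) (a b : S) :
    rankOneHamiltonian α β ψ a b =
      α * (1 : Matrix S S ℂ) a b - β * (ψ a * (starRingEnd ℂ) (ψ b)) := by
  simp [rankOneHamiltonian, vecMulVec_apply]

theorem rankOneHamiltonian_mulVec (α β : ℝ) (ψ v : S → ℂ) :
    rankOneHamiltonian α β ψ *ᵥ v = (α : ℂ) • v - ((β : ℂ) * (star ψ ⬝ᵥ v)) • ψ := by
  ext s
  simp [rankOneHamiltonian, sub_mulVec, smul_mulVec, vecMulVec_mulVec]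
  ring

theorem isGappedGroundState_rankOneHamiltonian {Δ α β : ℝ} (hβ : Δ ≤ β) {ψ : S → ℂ}
    (hψ : weight ψ = 1) : IsGappedGroundState Δ (rankOneHamiltonian α β ψ) ψ where
  hermitian := rankOneHamiltonian_isHermitian α β ψ
  normalized := hψ
  gapped := by
    refine ⟨α - β, ?_, fun μ v hv hψv hμ => ?_⟩
    · rw [rankOneHamiltonian_mulVec, ← ofReal_weight, hψ]
      push_cast
      rw [mul_one, sub_smul]
    · rw [rankOneHamiltonian_mulVec, hψv, mul_zero, zero_smul, sub_zero] at hμ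
      have : (α : ℂ) = μ := smul_left_injective ℂ hv hμ
      have : α = μ := by exact_mod_cast this
      linarith

open scoped Matrix.Norms.Operator in
theorem Matrix.exp_smul_of_isIdempotentElem {P : Matrix S S ℂ} (hP : IsIdempotentElem P) (z : ℂ) :
    NormedSpace.exp (z • P) = 1 + (Complex.exp z - 1) • P :=
  NormedSpace.exp_smul_of_isIdempotentElem hP z

theorem evolution_rankOneHamiltonian_mulVec {α β : ℝ} {ψ : S → ℂ} (hψ : weight ψ = 1) (t : ℝ)
    (y : S → ℂ) :
    evolution (rankOneHamiltonian α β ψ) t *ᵥ y = Complex.exp (Complex.I * (α * t : ℝ)) •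
      (y + ((Complex.exp (Complex.I * (-(β * t) : ℝ)) - 1) * (star ψ ⬝ᵥ y)) • ψ) := by
  have h : (Complex.I * (t : ℂ)) • rankOneHamiltonian α β ψ =
      (Complex.I * (α * t : ℝ)) • (1 : Matrix S S ℂ) +
        (Complex.I * (-(β * t) : ℝ)) • vecMulVec ψ (star ψ) := by
    rw [rankOneHamiltonian, smul_sub, smul_smul, smul_smul, sub_eq_add_neg, ← neg_smul]
    push_cast
    ring_nf
  rw [evolution, h, Matrix.exp_add_of_commute _ _ ((Commute.one_left _).smul_left _),
    Matrix.exp_smul_of_isIdempotentElem IsIdempotentElem.one,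
    Matrix.exp_smul_of_isIdempotentElem (isIdempotentElem_vecMulVec hψ)]
  rw [← mulVec_mulVec]
  ext s
  simp [add_mulVec, smul_mulVec, vecMulVec_mulVec]
  ring

/-- Up to a phase, the evolutions differ by `(e^{-iβt} - 1)` times the difference of the two
projections, whose norm is at most `2d`. -/
theorem evolutionsClose_rankOneHamiltonian {α β d : ℝ} (hd : 0 ≤ d) {ψ ψ' : S → ℂ}
    (hψ : weight ψ = 1) (hψ' : weight ψ' = 1) (h : weight (ψ' - ψ) ≤ d ^ 2) :
    EvolutionsClose (2 * |β| * d) (rankOneHamiltonian α β ψ) (rankOneHamiltonian α β ψ') := by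
  intro t y
  have hu : ∀ φ : S → ℂ, weight φ = 1 → ‖WithLp.toLp 2 φ‖ = 1 := fun φ hφ => by
    rwa [weight_eq_norm_sq, pow_eq_one_iff_of_nonneg (norm_nonneg _) two_ne_zero] at hφ
  have hd' : ‖WithLp.toLp 2 (ψ' - ψ)‖ ≤ d :=
    le_of_sq_le_sq (by rwa [← weight_eq_norm_sq]) hd
  have hdot : ∀ φ : S → ℂ, ‖star φ ⬝ᵥ y‖ ≤ ‖WithLp.toLp 2 φ‖ * ‖WithLp.toLp 2 y‖ := fun φ => by
    have := norm_inner_le_norm (𝕜 := ℂ) (WithLp.toLp 2 φ) (WithLp.toLp 2 y)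
    rwa [EuclideanSpace.inner_toLp_toLp, dotProduct_comm] at this
  have hP : ‖WithLp.toLp 2 ((star ψ' ⬝ᵥ y) • ψ' - (star ψ ⬝ᵥ y) • ψ)‖ ≤
      2 * d * ‖WithLp.toLp 2 y‖ := by
    have e : (star ψ' ⬝ᵥ y) • ψ' - (star ψ ⬝ᵥ y) • ψ =
        (star ψ' ⬝ᵥ y) • (ψ' - ψ) + (star (ψ' - ψ) ⬝ᵥ y) • ψ := by
      rw [star_sub, sub_dotProduct, sub_smul, smul_sub]; abel
    rw [e, WithLp.toLp_add, WithLp.toLp_smul, WithLp.toLp_smul]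
    refine (norm_add_le _ _).trans ?_
    rw [norm_smul, norm_smul, hu ψ hψ]
    have h1 := hdot ψ'
    have h2 := hdot (ψ' - ψ)
    rw [hu ψ' hψ', one_mul] at h1
    have h3 := mul_le_mul h1 hd' (norm_nonneg _) (norm_nonneg _)
    have h4 := mul_le_mul_of_nonneg_right hd' (norm_nonneg (WithLp.toLp 2 y))
    linarith
  rw [evolution_rankOneHamiltonian_mulVec hψ, evolution_rankOneHamiltonian_mulVec hψ']
  have e : ∀ a b : ℂ, a • (y + (b * (star ψ' ⬝ᵥ y)) • ψ') - a • (y + (b * (star ψ ⬝ᵥ y)) • ψ) =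
      (a * b) • ((star ψ' ⬝ᵥ y) • ψ' - (star ψ ⬝ᵥ y) • ψ) := fun a b => by
    ext s; simp; ring
  rw [e, weight_eq_norm_sq, weight_eq_norm_sq, WithLp.toLp_smul, norm_smul, norm_mul,
    Complex.norm_exp_I_mul_ofReal, one_mul, ← mul_pow]
  have hb : ‖Complex.exp (Complex.I * (-(β * t) : ℝ)) - 1‖ ≤ |β| * |t| := by
    refine (Real.norm_exp_I_mul_ofReal_sub_one_le).trans ?_
    rw [Real.norm_eq_abs, abs_neg, abs_mul]
  refine pow_le_pow_left₀ (by positivity) ?_ 2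
  refine (mul_le_mul hb hP (norm_nonneg _) (by positivity)).trans_eq (by ring)

theorem norm_toEuclideanCLM_rankOneHamiltonian_le {β : ℝ} {ψ : S → ℂ} (hψ : weight ψ = 1) :
    ‖Matrix.toEuclideanCLM (𝕜 := ℂ) (rankOneHamiltonian 0 β ψ)‖ ≤ |β| := by
  refine ContinuousLinearMap.opNorm_le_bound _ (abs_nonneg _) fun y => ?_
  have hu : ‖WithLp.toLp 2 ψ‖ = 1 := by
    rwa [weight_eq_norm_sq, pow_eq_one_iff_of_nonneg (norm_nonneg _) two_ne_zero] at hψ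
  have hdot := norm_inner_le_norm (𝕜 := ℂ) (WithLp.toLp 2 ψ) y
  rw [EuclideanSpace.inner_eq_star_dotProduct, dotProduct_comm, hu, one_mul] at hdot
  have e : Matrix.toEuclideanCLM (𝕜 := ℂ) (rankOneHamiltonian 0 β ψ) y =
      -(((β : ℂ) * (star ψ ⬝ᵥ y.ofLp)) • WithLp.toLp 2 ψ) := by
    have := rankOneHamiltonian_mulVec 0 β ψ y.ofLp
    ext s
    simpa using congrFun this s
  rw [e, norm_neg, norm_smul, norm_mul, hu, mul_one, Complex.norm_real, Real.norm_eq_abs]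
  exact mul_le_mul_of_nonneg_left hdot (abs_nonneg _)

end RankOne

/-! ### The lower bound for a family of rank-one Hamiltonians -/

namespace BlackBoxAlg

variable {S : Type} [Fintype S] [DecidableEq S]

theorem exists_le_evolutionTime {p : ℝ} (hp : 0 < p) {N : ℕ} (hN : 8 / p ≤ N) {Δ ε α β : ℝ}
    (hΔ : 0 < Δ) (hε : 0 < ε) (hεN : ε < min 1 p / (40 * N)) (hβ : |β| ≤ 2 * Δ)
    {ψ : ℝ → S → ℂ} (hψ : ∀ θ, weight (ψ θ) = 1)
    (hψψ : ∀ θ θ', weight (ψ θ' - ψ θ) ≤ (θ' - θ) ^ 2) {A : Matrix S S ℂ} {g : ℝ → ℝ}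
    (hg : ∀ x, 0 ≤ x → x ≤ 1 → expectation A (ψ (g x)) = x)
    (hg' : ∀ x, 0 ≤ x → x ≤ 1 → |g x - g 0| ≤ 5 / 3 * x)
    {𝒜 : BlackBoxAlg S 1}
    (h𝒜 : ∀ θ, 𝒜.Learns A ε p (rankOneHamiltonian α β (ψ θ)) (ψ θ)) :
    ∃ θ, p / (320 * N) / (Δ * ε) ≤ 𝒜.evolutionTime (rankOneHamiltonian α β (ψ θ)) (ψ θ) := by
  have hN0 : (0 : ℝ) < N := lt_of_lt_of_le (by positivity) hN
  have hH := fun θ => rankOneHamiltonian_isHermitian α β (ψ θ)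
  rw [lt_div_iff₀ (by positivity)] at hεN
  have hx : ∀ k : Fin N, 0 ≤ 3 * ε * k ∧ 3 * ε * k ≤ 3 * ε * N ∧ 3 * ε * N ≤ 1 := fun k => by
    refine ⟨by positivity, ?_, ?_⟩
    · have : ((k : ℕ) : ℝ) ≤ N := by exact_mod_cast k.2.le
      gcongr
    · nlinarith [min_le_left 1 p]
  -- Targets `3ε` apart keep windows of radius `ε` disjoint.
  set G : Fin N → Set ℝ := fun k => {x | |x - 3 * ε * k| ≤ ε} with hGdef
  have hG : Pairwise fun k l => Disjoint (G k) (G l) := by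
    intro k l hkl
    refine Set.disjoint_left.2 fun x hxk hxl => ?_
    simp only [hGdef, Set.mem_ofPred_eq, abs_le] at hxk hxl
    rcases lt_or_gt_of_ne hkl with h | h
    · have : ((k : ℕ) : ℝ) + 1 ≤ (l : ℕ) := by exact_mod_cast h
      nlinarith
    · have : ((l : ℕ) : ℝ) + 1 ≤ (k : ℕ) := by exact_mod_cast h
      nlinarith
  have hw : ∀ φ : S → ℂ, weight (initialState φ) = weight φ := fun φ => by
    simp [weight_prod, initialState]
  have hsum := sum_outputProb_le_weight (hH (g 0)) hG 𝒜 (initialState (ψ (g 0)))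
  rw [hw, hψ] at hsum
  obtain ⟨k, hk⟩ : ∃ k, 𝒜.outputProb (rankOneHamiltonian α β (ψ (g 0))) (G k)
      (initialState (ψ (g 0))) ≤ 1 / N := by
    by_contra! hcon
    have : Nonempty (Fin N) := ⟨⟨0, by exact_mod_cast hN0⟩⟩
    have := Finset.sum_lt_sum_of_nonempty Finset.univ_nonempty fun k _ => hcon k
    rw [Finset.sum_const, Finset.card_univ, Fintype.card_fin, nsmul_eq_mul,
      mul_one_div_cancel hN0.ne'] at this
    linarith
  obtain ⟨hx0, hx1, hx2⟩ := hx k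
  set θ := g (3 * ε * k)
  have hθ : |θ - g 0| ≤ 5 * ε * N := (hg' _ hx0 (hx1.trans hx2)).trans (by linarith)
  have hlearn := h𝒜 θ
  rw [Learns, hg _ hx0 (hx1.trans hx2)] at hlearn
  have hd : weight (ψ θ - ψ (g 0)) ≤ (5 * ε * N) ^ 2 :=
    (hψψ _ _).trans (sq_le_sq' (abs_le.1 hθ).1 (abs_le.1 hθ).2)
  have hyb := outputProb_le_of_evolutionsClose (by positivity) (hH (g 0)) (hH θ)
    (evolutionsClose_rankOneHamiltonian (by positivity) (hψ _) (hψ _) hd) (G k) 𝒜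
    (initialState (ψ (g 0))) (initialState (ψ θ))
  have hwd : weight (initialState (ψ θ) - initialState (ψ (g 0))) ≤ p / 8 := by
    have e : initialState (ψ θ) - initialState (ψ (g 0)) = initialState (ψ θ - ψ (g 0)) := rfl
    rw [e, hw]
    refine hd.trans ?_
    have h1 : 5 * ε * N ≤ 1 := by linarith [min_le_left 1 p]
    have h2 : 5 * ε * N ≤ p / 8 := by linarith [min_le_right 1 p]
    have h3 : 0 ≤ 5 * ε * N := by positivity
    -- The square is at most `1 * (p / 8)`.
    nlinarith
  have hNp : 1 / (N : ℝ) ≤ p / 8 := by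
    rw [div_le_iff₀ hp] at hN
    rw [div_le_iff₀ hN0]; linarith
  by_contra! hcon
  have h0 := hcon (g 0)
  have h1 := hcon θ
  simp only [evolutionTime] at h0 h1
  set T := 𝒜.expectedTime (rankOneHamiltonian α β (ψ (g 0))) (initialState (ψ (g 0)))
  set T' := 𝒜.expectedTime (rankOneHamiltonian α β (ψ θ)) (initialState (ψ θ))
  have hT : 2 * |β| * (5 * ε * N) * (T + T') ≤
      2 * |β| * (5 * ε * N) * (2 * (p / (320 * N) / (Δ * ε))) := by
    refine mul_le_mul_of_nonneg_left ?_ (by positivity)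
    linarith
  have hT' : 2 * |β| * (5 * ε * N) * (2 * (p / (320 * N) / (Δ * ε))) ≤
      2 * (2 * Δ) * (5 * ε * N) * (2 * (p / (320 * N) / (Δ * ε))) := by
    gcongr
  -- The constant `320` is chosen to make this `p / 8`. The hybrid bound then totals at most `2 *
  -- (p/8 + p/8 + p/8) < p`.
  have e : 2 * (2 * Δ) * (5 * ε * N) * (2 * (p / (320 * N) / (Δ * ε))) = p / 8 := by
    field_simp
    norm_num
  have : p ≤ _ := hlearn.trans hyb
  linarith

end BlackBoxAlg

/-! ### The single-qubit family -/

section Qubit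

theorem weight_qubitGroundState (θ : ℝ) : weight (qubitGroundState θ) = 1 := by
  have : ‖Complex.exp (Complex.I * (θ : ℂ))‖ = 1 := Complex.norm_exp_I_mul_ofReal θ
  simp [weight, qubitGroundState, Fin.sum_univ_two, this]
  norm_num

theorem weight_qubitGroundState_sub_le (θ θ' : ℝ) :
    weight (qubitGroundState θ' - qubitGroundState θ) ≤ (θ' - θ) ^ 2 := by
  have e : Complex.exp (Complex.I * (θ' : ℂ)) - Complex.exp (Complex.I * (θ : ℂ)) =
      Complex.exp (Complex.I * (θ : ℂ)) * (Complex.exp (Complex.I * ((θ' - θ : ℝ) : ℂ)) - 1) := by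
    rw [mul_sub, ← Complex.exp_add]
    push_cast
    ring_nf
  have h : ‖Complex.exp (Complex.I * (θ' : ℂ)) - Complex.exp (Complex.I * (θ : ℂ))‖ ≤
      |θ' - θ| := by
    rw [e, norm_mul, Complex.norm_exp_I_mul_ofReal, one_mul]
    exact Real.norm_exp_I_mul_ofReal_sub_one_le
  have h2 := pow_le_pow_left₀ (norm_nonneg _) h 2
  rw [sq_abs] at h2
  have h3 : weight (qubitGroundState θ' - qubitGroundState θ) =
      2⁻¹ * ‖Complex.exp (Complex.I * (θ' : ℂ)) - Complex.exp (Complex.I * (θ : ℂ))‖ ^ 2 := by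
    simp [weight, qubitGroundState, Fin.sum_univ_two, ← mul_sub, mul_pow]
  rw [h3]
  nlinarith [sq_nonneg (θ' - θ)]

theorem inv_sqrt_two_mul_self : ((Real.sqrt 2 : ℂ))⁻¹ * ((Real.sqrt 2 : ℂ))⁻¹ = 2⁻¹ := by
  rw [← mul_inv, ← Complex.ofReal_mul, Real.mul_self_sqrt (by norm_num)]
  norm_num

theorem conj_exp_I_mul (θ : ℝ) : (starRingEnd ℂ) (Complex.exp (Complex.I * (θ : ℂ))) =
    Real.cos θ - Real.sin θ * Complex.I := by
  rw [mul_comm, Complex.exp_mul_I]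
  simp [← Complex.ofReal_cos, ← Complex.ofReal_sin, sub_eq_add_neg]

theorem exp_I_mul (θ : ℝ) : Complex.exp (Complex.I * (θ : ℂ)) =
    Real.cos θ + Real.sin θ * Complex.I := by
  rw [mul_comm, Complex.exp_mul_I, Complex.ofReal_cos, Complex.ofReal_sin]

theorem expectation_qubitGroundState (σ : Matrix (Fin 2) (Fin 2) ℂ) (θ : ℝ) :
    expectation σ (qubitGroundState θ) =
      (2⁻¹ * (σ 0 0 + σ 0 1 * (Real.cos θ + Real.sin θ * Complex.I) +
        (Real.cos θ - Real.sin θ * Complex.I) * σ 1 0 +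
        (Real.cos θ - Real.sin θ * Complex.I) * σ 1 1 *
          (Real.cos θ + Real.sin θ * Complex.I))).re := by
  rw [expectation, ← inv_sqrt_two_mul_self, ← conj_exp_I_mul, ← exp_I_mul]
  congr 1
  simp [qubitGroundState, dotProduct, mulVec, Fin.sum_univ_two]
  ring

theorem expectation_pauliX_qubitGroundState (θ : ℝ) :
    expectation pauliX (qubitGroundState θ) = Real.cos θ := by
  rw [expectation_qubitGroundState]
  simp [pauliX, -Complex.ofReal_cos, -Complex.ofReal_sin]
  ring

theorem expectation_pauliY_qubitGroundState (θ : ℝ) :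
    expectation pauliY (qubitGroundState θ) = Real.sin θ := by
  rw [expectation_qubitGroundState]
  simp [pauliY, -Complex.ofReal_cos, -Complex.ofReal_sin]
  ring

/-- Spectral decomposition with energies `±Δ`; the true gap is `2Δ`. -/
theorem qubitHamiltonian_eq (Δ θ : ℝ) :
    qubitHamiltonian Δ θ = rankOneHamiltonian Δ (2 * Δ) (qubitGroundState θ) := by
  have h1 : Complex.exp (Complex.I * (θ : ℂ)) *
      (starRingEnd ℂ) (Complex.exp (Complex.I * (θ : ℂ))) = 1 := by
    rw [Complex.mul_conj', Complex.norm_exp_I_mul_ofReal]; simp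
  have h2 := inv_sqrt_two_mul_self
  have h3 := exp_I_mul θ
  have h4 := conj_exp_I_mul θ
  set r := ((Real.sqrt 2 : ℂ))⁻¹ with hr
  have hrc : (starRingEnd ℂ) r = r := by simp [hr]
  ext a b
  rw [rankOneHamiltonian_apply]
  fin_cases a <;> fin_cases b <;>
    simp [qubitHamiltonian, pauliX, pauliY, qubitGroundState,
      -Complex.ofReal_cos, -Complex.ofReal_sin, ← hr, hrc]
  · linear_combination (2 * Δ : ℂ) * h2
  · linear_combination (-2 * Δ * (Real.cos θ - Real.sin θ * Complex.I) : ℂ) * h2 - 2 * Δ * r * r * h4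
  · linear_combination (-2 * Δ * (Real.cos θ + Real.sin θ * Complex.I) : ℂ) * h2 - 2 * Δ * r * r * h3
  · linear_combination (2 * Δ : ℂ) * h2 + 2 * Δ * r * r * h1

/-- Jordan's inequality, with `π / 2 < 5 / 3`. -/
theorem Real.abs_arcsin_le {x : ℝ} (h0 : 0 ≤ x) (h1 : x ≤ 1) : |Real.arcsin x| ≤ 5 / 3 * x := by
  have ha := Real.arcsin_nonneg.2 h0
  rw [abs_of_nonneg ha]
  have h := Real.mul_le_sin ha (Real.arcsin_le_pi_div_two x)
  rw [Real.sin_arcsin (by linarith) h1, div_mul_eq_mul_div, div_le_iff₀ Real.pi_pos] at h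
  nlinarith [Real.pi_lt_d2]

/-- The reference `g 0` has expectation `0`, where `cos` or `sin` has slope of modulus 1. Near an
extremum the inverse would not be Lipschitz. -/
theorem exists_expectation_qubitGroundState_eq {σ : Matrix (Fin 2) (Fin 2) ℂ}
    (hσ : σ ∈ ({pauliX, pauliY} : Set (Matrix (Fin 2) (Fin 2) ℂ))) :
    ∃ g : ℝ → ℝ, (∀ x, 0 ≤ x → x ≤ 1 → expectation σ (qubitGroundState (g x)) = x) ∧
      ∀ x, 0 ≤ x → x ≤ 1 → |g x - g 0| ≤ 5 / 3 * x := by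
  rcases hσ with rfl | rfl
  · refine ⟨Real.arccos, fun x h0 h1 => ?_, fun x h0 h1 => ?_⟩
    · rw [expectation_pauliX_qubitGroundState, Real.cos_arccos (by linarith) h1]
    · rw [Real.arccos, Real.arccos, Real.arcsin_zero, sub_zero, sub_sub_cancel_left, abs_neg]
      exact Real.abs_arcsin_le h0 h1
  · refine ⟨Real.arcsin, fun x h0 h1 => ?_, fun x h0 h1 => ?_⟩
    · rw [expectation_pauliY_qubitGroundState, Real.sin_arcsin (by linarith) h1]
    · rw [Real.arcsin_zero, sub_zero]
      exact Real.abs_arcsin_le h0 h1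

end Qubit

/-! ### Embedding one qubit into `n` qubits -/

section Extend

variable {I J : Type} [Fintype I] [Fintype J] {e : I → J}

theorem sum_mul_extend (he : e.Injective) (ψ : I → ℂ) (f : J → ℂ) :
    ∑ j, f j * Function.extend e ψ 0 j = ∑ i, f (e i) * ψ i := by
  refine (Fintype.sum_of_injective e he _ _ (fun j hj => ?_) fun i => ?_).symm
  · rw [Function.extend_apply' _ _ _ (by simpa using hj)]; simp
  · rw [he.extend_apply]

theorem expectation_extend (he : e.Injective) (A : Matrix J J ℂ) (ψ : I → ℂ) :
    expectation A (Function.extend e ψ 0) = expectation (A.submatrix e e) ψ := by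
  have h : star (Function.extend e ψ 0) = Function.extend e (star ψ) 0 := by
    ext j
    by_cases hj : ∃ i, e i = j
    · obtain ⟨i, rfl⟩ := hj; simp [he.extend_apply]
    · simp [Function.extend_apply' _ _ _ hj]
  rw [expectation, expectation, h, dotProduct_comm]
  simp only [dotProduct, mulVec, sum_mul_extend he, submatrix_apply, Pi.star_apply]
  simp only [mul_comm]

theorem weight_extend (he : e.Injective) (ψ : I → ℂ) :
    weight (Function.extend e ψ 0) = weight ψ := by
  refine (Fintype.sum_of_injective e he _ _ (fun j hj => ?_) fun i => ?_).symm
  · rw [Function.extend_apply' _ _ _ (by simpa using hj)]; simp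
  · rw [he.extend_apply]

theorem extend_sub_extend {I J : Type} {e : I → J} (he : e.Injective) (ψ ψ' : I → ℂ) :
    Function.extend e ψ' 0 - Function.extend e ψ 0 = Function.extend e (ψ' - ψ) 0 := by
  ext j
  by_cases hj : ∃ i, e i = j
  · obtain ⟨i, rfl⟩ := hj; simp [he.extend_apply]
  · simp [Function.extend_apply' _ _ _ hj]

theorem update_zero_injective {n : ℕ} (i : Fin n) :
    (fun b : Fin 2 => Function.update (0 : Fin n → Fin 2) i b).Injective := by
  intro a b h
  simpa using congrFun h i

theorem submatrix_onQubit {n : ℕ} (i : Fin n) (σ : Matrix (Fin 2) (Fin 2) ℂ) :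
    (onQubit i σ).submatrix (fun b => Function.update 0 i b) (fun b => Function.update 0 i b) =
      σ := by
  ext a b
  simp only [submatrix_apply, onQubit, of_apply, Function.update_self]
  exact if_pos fun j hj => by simp [hj]

end Extend

theorem fact1 (p : ℝ) (hp : 0 < p) :
    ∃ c ε₀ : ℝ, 0 < c ∧ 0 < ε₀ ∧ ∀ Δ ε : ℝ, 0 < Δ → 0 < ε → ε < ε₀ →
      (∀ θ : ℝ, IsGappedGroundState Δ (qubitHamiltonian Δ θ) (qubitGroundState θ)) ∧
      (∀ σ ∈ ({pauliX, pauliY} : Set (Matrix (Fin 2) (Fin 2) ℂ)),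
        (∀ 𝒜 : BlackBoxAlg (Fin 2) 1,
          (∀ θ : ℝ, 𝒜.Learns σ ε p (qubitHamiltonian Δ θ) (qubitGroundState θ)) →
          ∃ θ : ℝ, c / (Δ * ε) ≤
            𝒜.evolutionTime (qubitHamiltonian Δ θ) (qubitGroundState θ)) ∧
        (∀ (n : ℕ) (i : Fin n) (Λ : ℝ), Δ ≤ Λ → ∀ 𝒜 : BlackBoxAlg (Fin n → Fin 2) 1,
          (∀ (H : Matrix (Fin n → Fin 2) (Fin n → Fin 2) ℂ) (ψ : (Fin n → Fin 2) → ℂ),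
            IsGappedGroundState Δ H ψ → ‖Matrix.toEuclideanCLM (𝕜 := ℂ) H‖ ≤ Λ →
            𝒜.Learns (onQubit i σ) ε p H ψ) →
          ∃ (H : Matrix (Fin n → Fin 2) (Fin n → Fin 2) ℂ) (ψ : (Fin n → Fin 2) → ℂ),
            IsGappedGroundState Δ H ψ ∧ ‖Matrix.toEuclideanCLM (𝕜 := ℂ) H‖ ≤ Λ ∧
            c / (Δ * ε) ≤ 𝒜.evolutionTime H ψ)) := by
  obtain ⟨N, hN⟩ := exists_nat_ge (8 / p)
  have hN0 : (0 : ℝ) < N := lt_of_lt_of_le (by positivity) hN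
  refine ⟨p / (320 * N), min 1 p / (40 * N), by positivity, by positivity,
    fun Δ ε hΔ hε hεN => ⟨fun θ => ?_, fun σ hσ => ?_⟩⟩
  · rw [qubitHamiltonian_eq]
    exact isGappedGroundState_rankOneHamiltonian (by linarith) (weight_qubitGroundState θ)
  obtain ⟨g, hg, hg'⟩ := exists_expectation_qubitGroundState_eq hσ
  refine ⟨fun 𝒜 h𝒜 => ?_, fun n i Λ hΛ 𝒜 h𝒜 => ?_⟩
  · simp only [qubitHamiltonian_eq] at h𝒜 ⊢
    exact BlackBoxAlg.exists_le_evolutionTime hp hN hΔ hε hεN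
      (abs_of_pos (by positivity : 0 < 2 * Δ)).le weight_qubitGroundState
      weight_qubitGroundState_sub_le hg hg' h𝒜
  · have he := update_zero_injective i
    -- Adding idle qubits to `H_θ` would make the ground state degenerate. The Hamiltonian `-Δ
    -- |Ψ⟩⟨Ψ|` keeps it simple, with norm at most `Δ ≤ Λ`.
    set Ψ : ℝ → (Fin n → Fin 2) → ℂ := fun θ =>
      Function.extend (fun b : Fin 2 => Function.update 0 i b) (qubitGroundState θ) 0
    have hΨ : ∀ θ, weight (Ψ θ) = 1 := fun θ =>
      (weight_extend he _).trans (weight_qubitGroundState θ)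
    have hgap : ∀ θ, IsGappedGroundState Δ (rankOneHamiltonian 0 Δ (Ψ θ)) (Ψ θ) := fun θ =>
      isGappedGroundState_rankOneHamiltonian le_rfl (hΨ θ)
    have hnorm : ∀ θ, ‖Matrix.toEuclideanCLM (𝕜 := ℂ) (rankOneHamiltonian 0 Δ (Ψ θ))‖ ≤ Λ :=
      fun θ => (norm_toEuclideanCLM_rankOneHamiltonian_le (hΨ θ)).trans
        ((abs_of_pos hΔ).trans_le hΛ)
    obtain ⟨θ, hθ⟩ := BlackBoxAlg.exists_le_evolutionTime (α := 0) (β := Δ) (ψ := Ψ)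
      (A := onQubit i σ) hp hN hΔ hε hεN (by rw [abs_of_pos hΔ]; linarith) hΨ
      (fun θ θ' => by
        rw [extend_sub_extend he, weight_extend he]
        exact weight_qubitGroundState_sub_le θ θ')
      (fun x h0 h1 => by
        rw [expectation_extend he, submatrix_onQubit]
        exact hg x h0 h1)
      hg' (fun θ => h𝒜 _ _ (hgap θ) (hnorm θ))
    exact ⟨_, _, hgap θ, hnorm θ, hθ⟩
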